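/- Let $K\ge 2$ and let $n_{\rm d},n_{\rm i}\ge 0$ be integers, $m:=\max\{n_{\rm d},n_{\rm i}\}$. In the symmetric linear deterministic $K$-user channel the inputs $X_1,\dots,X_K$ and outputs $Y_1,\dots,Y_K$ are vectors in $\mathbb F_2^m$ and $$Y_\ell=\mathbf S^{m-n_{\rm d}}X_\ell+\sum_{i\ne\ell}\mathbf S^{m-n_{\rm i}}X_i ,\qquad \ell\in[1:K],$$ where $\mathbf S$ is the $m\times m$ binary shift matrix (ones exactly on the first subdiagonal). The messages $W_1,\dots,W_K$ are independent and $W_i$ is uniform on $[1:\lceil 2^{NR_i}\rceil]$; a code of block length $N$ consists of encoders and of decoders $\widehat W_\ell=g_\ell(Y_\ell^N)$, and its error probability is $\max_\ell\mathbb P[\widehat W_\ell\ne W_\ell]$. With cumulative message sharing, $X_i^N$ is a function of $(W_1,\dots,W_i)$; with cognition only at transmitter $K$, $X_i^N$ is a function of $W_i$ for $i<K$ and $X_K^N$ is a function of $(W_1,\dots,W_K)$. A tuple $(R_1,\dots,R_K)$ of non-negative rates is achievable if there are codes for all block lengths $N$ whose error probability tends to $0$ as $N\to\infty$; the sum-capacity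 is the maximum of $R_1+\dots+R_K$ over the achievable tuples. Then the sum-capacity $C$ with cumulative message sharing exists and equals the sum-rate outer bound $$\max_{P_{X_1,\dots,X_K}}\ \sum_{j=1}^{K} I\big(Y_j;X_j,\dots,X_K\,\big|\,X_1,\dots,X_{j-1},Y_1,\dots,Y_{j-1}\big)$$ (mutual information in bits, maximum over all joint input distributions). Its value is $C=K\max\{n_{\rm d},n_{\rm i}\}-n_{\rm i}$ if $n_{\rm d}\ne n_{\rm i}$ and $C=n_{\rm d}$ if $n_{\rm d}=n_{\rm i}$; that is, if $n_{\rm d}>0$ and $n_{\rm i}=\alpha n_{\rm d}$, then $C/n_{\rm d}=K\max\{1,\alpha\}-\alpha$ for $\alpha\ne 1$ and $C/n_{\rm d}=1$ for $\alpha=1$. Moreover, $C$ is also the sum-capacity with cognition only at transmitter $K$, and there it is achieved by linear codes without error: there are integers $k_1,\dots,k_K\ge 0$ with $k_1+\dots+k_K=C$ such that $(k_1,\dots,k_K)$ is achievable and, for every $N$, there is a code of block length $N$ with cognition only at transmitter $K$, with messages $W_i\in\mathbb F_2^{Nk_i}$, with all encoders and decoders $\mathbb F_2$-linear, and with error probability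 $0$. -/

import Mathlib

namespace CIFC

/-! ### The linear deterministic channel -/

/-- The binary shift matrix of dimension `m`: ones on the first subdiagonal, zeros elsewhere. -/
def shift (m : ℕ) : Matrix (Fin m) (Fin m) (ZMod 2) :=
  Matrix.of fun a b => if (a : ℕ) = (b : ℕ) + 1 then 1 else 0

/-- `m = max n_{ℓ i}`, the number of bit levels for the gains `n`. -/
def levels {K : ℕ} (n : Fin K → Fin K → ℕ) : ℕ :=
  Finset.univ.sup fun p : Fin K × Fin K => n p.1 p.2

/-- Input and output alphabet: binary vectors of dimension `m`. -/
abbrev Sig {K : ℕ} (n : Fin K → Fin K → ℕ) : Type := Fin (levels n) → ZMod 2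

/-- The signal at receiver `l`: `Y_l = ∑ i, S ^ (m - n l i) X_i`. -/
def output {K : ℕ} (n : Fin K → Fin K → ℕ) (l : Fin K) (x : Fin K → Sig n) : Sig n :=
  ∑ i, (shift (levels n) ^ (levels n - n l i)).mulVec (x i)

/-- Symmetric gains: `nd` on the direct links, `ni` on the interfering links. -/
def symGain (K nd ni : ℕ) (l i : Fin K) : ℕ := if l = i then nd else ni

/-! ### Message knowledge, codes and capacity -/

/-- Cumulative message sharing: transmitter `i` knows the messages of users `j ≤ i`. -/
def cms (K : ℕ) (i : Fin K) : Finset (Fin K) := Finset.univ.filter fun j => j ≤ i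

/-- The last transmitter knows all messages; every other one knows only its own. -/
def lastOnly (K : ℕ) (i : Fin K) : Finset (Fin K) :=
  if (i : ℕ) + 1 = K then Finset.univ else {i}

/-- A block code of length `N` with message sets `M j`, where transmitter `i` encodes the messages
with index in `A i`. -/
structure Code {K : ℕ} (n : Fin K → Fin K → ℕ) (A : Fin K → Finset (Fin K))
    (M : Fin K → Type) (N : ℕ) where
  enc : ∀ i, (∀ j : {j // j ∈ A i}, M j.1) → (Fin N → Sig n)
  dec : ∀ l, (Fin N → Sig n) → M l

namespace Code

variable {K : ℕ} {n : Fin K → Fin K → ℕ} {A : Fin K → Finset (Fin K)} {M : Fin K → Type} {N : ℕ}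

/-- The block received at receiver `l` when the messages are `w`. -/
def received (c : Code n A M N) (w : ∀ j, M j) (l : Fin K) : Fin N → Sig n :=
  fun t => output n l fun i => c.enc i (fun j => w j.1) t

/-- Error probability of receiver `l` for independent, uniformly distributed messages. -/
noncomputable def errorAt (c : Code n A M N) (l : Fin K) : ℝ :=
  (Nat.card {w : ∀ j, M j // c.dec l (c.received w l) ≠ w l} : ℝ) / (Nat.card (∀ j, M j) : ℝ)

/-- The largest error probability among the receivers. -/
noncomputable def errorProb (c : Code n A M N) : ℝ := ⨆ l, c.errorAt l

/-- All encoders and decoders are linear over the binary field. -/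
def IsLinear [∀ j, AddCommMonoid (M j)] [∀ j, Module (ZMod 2) (M j)] (c : Code n A M N) : Prop :=
  (∀ i, IsLinearMap (ZMod 2) (c.enc i)) ∧ ∀ l, IsLinearMap (ZMod 2) (c.dec l)

end Code

/-- The non-negative rate tuples `R` for which there is a sequence of codes, one for each block
length `N`, with `⌈2 ^ (N R_i)⌉` messages for user `i` and error probability tending to zero. -/
def capacityRegion {K : ℕ} (n : Fin K → Fin K → ℕ) (A : Fin K → Finset (Fin K)) :
    Set (Fin K → ℝ) :=
  {R | (∀ i, 0 ≤ R i) ∧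
    ∃ c : ∀ N : ℕ, Code n A (fun i => Fin ⌈(2 : ℝ) ^ ((N : ℝ) * R i)⌉₊) N,
      Filter.Tendsto (fun N => (c N).errorProb) Filter.atTop (nhds 0)}

/-- `C` is the maximum of `R_1 + ⋯ + R_K` over the capacity region. -/
def IsSumCapacity {K : ℕ} (n : Fin K → Fin K → ℕ) (A : Fin K → Finset (Fin K)) (C : ℝ) : Prop :=
  IsGreatest ((fun R : Fin K → ℝ => ∑ i, R i) '' capacityRegion n A) C

/-! ### The sum-rate outer bound -/

/-- Shannon entropy, in bits, of the random variable `f` under the law `P`. -/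
noncomputable def entropy {α β : Type} [Fintype β] (P : PMF α) (f : α → β) : ℝ :=
  ∑ b, Real.negMulLog (P.map f b).toReal / Real.log 2

/-- Conditional mutual information `I(f; g | h)`, in bits. -/
noncomputable def condMutualInfo {α β γ δ : Type} [Fintype β] [Fintype γ] [Fintype δ]
    (P : PMF α) (f : α → β) (g : α → γ) (h : α → δ) : ℝ :=
  entropy P (fun a => (f a, h a)) + entropy P (fun a => (g a, h a))
    - entropy P (fun a => (f a, g a, h a)) - entropy P h

/-- The sum-rate bound
`∑ j, I(Y_j; X_j, …, X_K | X_1, …, X_{j-1}, Y_1, …, Y_{j-1})` at the joint input law `P`. -/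
noncomputable def sumRateBound {K : ℕ} (n : Fin K → Fin K → ℕ) (P : PMF (Fin K → Sig n)) : ℝ :=
  ∑ j : Fin K, condMutualInfo P
    (fun x => output n j x)
    (fun x => fun i : {i : Fin K // j ≤ i} => x i.1)
    (fun x => ((fun i : {i : Fin K // i < j} => x i.1),
      (fun i : {i : Fin K // i < j} => output n i.1 x)))

/-- `C` is the maximum of the sum-rate bound over all joint input laws. -/
def IsSumRateOuterBound {K : ℕ} (n : Fin K → Fin K → ℕ) (C : ℝ) : Prop :=
  IsGreatest (Set.range fun P : PMF (Fin K → Sig n) => sumRateBound n P) C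

end CIFC

/-!
Once the inputs and outputs of the users before `j` are known, the output `Y_j` is known up to its
`j`-th *innovation*, the subspace of all values of `Y_j` for which these earlier signals vanish.
Its dimension bounds the `j`-th term of the sum-rate bound, with equality for uniform inputs. It
also bounds the rates: with cumulative message sharing, a correctly decoded message tuple can be
recovered user by user from the projections of the outputs to the innovations, because the inputs of
the users before `j` are functions of the messages found so far.

It remains to find a linear scheme whose message spaces contain the innovations. In the symmetric
channel `Y_l = (S ^ (m - nd) - S ^ (m - ni)) X_l + S ^ (m - ni) ∑ i, X_i`. If `nd ≠ ni`, then the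
first matrix is invertible, being the identity plus a nilpotent matrix over `𝔽₂`. The cognitive
transmitter can choose its input so that `∑ i, X_i` is any prescribed vector, hence so that
`S ^ (m - ni) ∑ i, X_i = 0`, and the freedom left in the choice of `∑ i, X_i` carries its own
message. If `nd = ni`, all receivers see the same signal, and the first user alone exhausts it.
-/

namespace CIFC

section Entropy

variable {α β γ δ : Type}

lemma negMulLog_sum_le {ι : Type*} (s : Finset ι) (q : ι → ℝ) (hq : ∀ i ∈ s, 0 ≤ q i) :
    Real.negMulLog (∑ i ∈ s, q i) ≤ ∑ i ∈ s, Real.negMulLog (q i) := by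
  rw [Real.negMulLog, neg_mul, Finset.sum_mul, ← Finset.sum_neg_distrib]
  refine Finset.sum_le_sum fun i hi => ?_
  rw [Real.negMulLog, neg_mul, neg_le_neg_iff]
  rcases (hq i hi).eq_or_lt with h | h
  · simp [← h]
  · exact mul_le_mul_of_nonneg_left (Real.log_le_log h (Finset.single_le_sum hq hi)) h.le

lemma sum_negMulLog_le {ι : Type*} [Fintype ι] [Nonempty ι] {p : ι → ℝ} (hp : ∀ i, 0 ≤ p i) :
    ∑ i, Real.negMulLog (p i) ≤
      Real.negMulLog (∑ i, p i) + (∑ i, p i) * Real.log (Fintype.card ι) := by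
  set n : ℝ := (Fintype.card ι : ℝ) with hn_def
  have hn : 0 < n := Nat.cast_pos.2 Fintype.card_pos
  have hJensen : n⁻¹ * ∑ i, Real.negMulLog (p i) ≤ Real.negMulLog (n⁻¹ * ∑ i, p i) := by
    simpa only [smul_eq_mul, ← Finset.mul_sum] using
      Real.concaveOn_negMulLog.le_map_sum (t := Finset.univ) (w := fun _ : ι => n⁻¹) (p := p)
        (fun _ _ => (inv_pos.2 hn).le) (by simp [← hn_def, hn.ne']) fun i _ => hp i
  refine le_of_mul_le_mul_left (hJensen.trans_eq ?_) (inv_pos.2 hn)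
  rw [Real.negMulLog_mul, show Real.negMulLog n⁻¹ = n⁻¹ * Real.log n by
    rw [Real.negMulLog, Real.log_inv]; ring]
  ring

lemma toReal_map_apply [Fintype β] [DecidableEq γ] (Q : PMF β) (φ : β → γ) (c : γ) :
    (Q.map φ c).toReal = ∑ b with φ b = c, (Q b).toReal := by
  rw [PMF.map_apply, tsum_fintype, ENNReal.toReal_sum, Finset.sum_filter]
  · refine Finset.sum_congr rfl fun b _ => ?_
    by_cases h : φ b = c <;> simp [h, eq_comm (a := c)]
  · intro b _
    split_ifs <;> simp [Q.apply_ne_top]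

lemma sum_toReal_eq_one [Fintype β] (Q : PMF β) : ∑ b, (Q b).toReal = 1 := by
  rw [← ENNReal.toReal_sum fun b _ => Q.apply_ne_top b, ← tsum_fintype (L := .unconditional β),
    Q.tsum_coe, ENNReal.toReal_one]

lemma sum_toReal_map_prodMk [Fintype γ] [Finite δ] (P : PMF α) (f : α → γ) (h : α → δ) (d : δ) :
    ∑ c, (P.map (fun a => (f a, h a)) (c, d)).toReal = (P.map h d).toReal := by
  classical
  have := Fintype.ofFinite δ
  have hmap : P.map h = (P.map fun a => (f a, h a)).map Prod.snd :=
    (PMF.map_comp (fun a => (f a, h a)) P Prod.snd).symm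
  rw [hmap, toReal_map_apply, Finset.sum_filter, Fintype.sum_prod_type]
  simp

lemma entropy_comp_le [Fintype β] [Fintype γ] (P : PMF α) (f : α → β) (φ : β → γ) :
    entropy P (φ ∘ f) ≤ entropy P f := by
  classical
  simp only [entropy, ← Finset.sum_div]
  refine div_le_div_of_nonneg_right ?_ (Real.log_nonneg one_le_two)
  calc ∑ c, Real.negMulLog (P.map (φ ∘ f) c).toReal
      ≤ ∑ c, ∑ b with φ b = c, Real.negMulLog (P.map f b).toReal := by
        refine Finset.sum_le_sum fun c _ => ?_
        rw [← PMF.map_comp, toReal_map_apply]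
        exact negMulLog_sum_le _ _ fun b _ => ENNReal.toReal_nonneg
    _ = ∑ b, Real.negMulLog (P.map f b).toReal := Finset.sum_fiberwise _ _ _

lemma entropy_le_of_factorsThrough [Fintype β] [Fintype γ] (P : PMF α) {f : α → β} {g : α → γ}
    (h : g.FactorsThrough f) : entropy P g ≤ entropy P f := by
  obtain ⟨a, -⟩ := P.support_nonempty
  have : Nonempty γ := ⟨g a⟩
  obtain ⟨φ, rfl⟩ := (Function.factorsThrough_iff g).1 h
  exact entropy_comp_le P f φ

lemma entropy_prodMk_le [Fintype γ] [Fintype δ] (P : PMF α) (f : α → γ) (h : α → δ) :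
    entropy P (fun a => (f a, h a)) ≤ entropy P h + Real.logb 2 (Fintype.card γ) := by
  obtain ⟨a, -⟩ := P.support_nonempty
  have : Nonempty γ := ⟨f a⟩
  simp only [entropy, Real.logb, ← Finset.sum_div, ← add_div]
  refine div_le_div_of_nonneg_right ?_ (Real.log_nonneg one_le_two)
  calc ∑ z, Real.negMulLog (P.map (fun a => (f a, h a)) z).toReal
      = ∑ d, ∑ c, Real.negMulLog (P.map (fun a => (f a, h a)) (c, d)).toReal := by
        rw [Fintype.sum_prod_type, Finset.sum_comm]
    _ ≤ ∑ d, (Real.negMulLog (P.map h d).toReal +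
          (P.map h d).toReal * Real.log (Fintype.card γ)) := by
        refine Finset.sum_le_sum fun d _ => ?_
        rw [← sum_toReal_map_prodMk P f h d]
        exact sum_negMulLog_le fun c => ENNReal.toReal_nonneg
    _ = ∑ d, Real.negMulLog (P.map h d).toReal + Real.log (Fintype.card γ) := by
        rw [Finset.sum_add_distrib, ← Finset.sum_mul, sum_toReal_eq_one, one_mul]

lemma condMutualInfo_eq_sub_of_factorsThrough [Fintype β] [Fintype γ] [Fintype δ] (P : PMF α)
    {f : α → β} {g : α → γ} {h : α → δ} (hf : f.FactorsThrough fun a => (g a, h a)) :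
    condMutualInfo P f g h = entropy P (fun a => (f a, h a)) - entropy P h := by
  have hfgh : entropy P (fun a => (f a, g a, h a)) = entropy P (fun a => (g a, h a)) :=
    le_antisymm (entropy_le_of_factorsThrough P fun _ _ hab => Prod.ext (hf hab) hab)
      (entropy_le_of_factorsThrough P fun _ _ hab => (Prod.ext_iff.1 hab).2)
  rw [condMutualInfo, hfgh]
  ring

lemma entropy_of_map_eq_uniformOfFintype [Fintype β] [Nonempty β] {P : PMF α} {f : α → β}
    (h : P.map f = PMF.uniformOfFintype β) : entropy P f = Real.logb 2 (Fintype.card β) := by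
  have hβ : (Fintype.card β : ℝ) ≠ 0 := Nat.cast_ne_zero.2 Fintype.card_ne_zero
  simp only [entropy, h, PMF.uniformOfFintype_apply, ENNReal.toReal_inv, ENNReal.toReal_natCast,
    Real.negMulLog, Real.log_inv, Real.logb, Finset.sum_const, Finset.card_univ, nsmul_eq_mul]
  field_simp

lemma map_uniformOfFintype_of_surjective {V W : Type} [AddGroup V] [AddGroup W] [Fintype V]
    [Fintype W] {f : V →+ W} (hf : Function.Surjective f) :
    (PMF.uniformOfFintype V).map f = PMF.uniformOfFintype W := by
  classical
  set Q := (PMF.uniformOfFintype V).map f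
  have hconst (w w' : W) : (Q w).toReal = (Q w').toReal := by
    rw [toReal_map_apply, toReal_map_apply]
    simp only [PMF.uniformOfFintype_apply, Finset.sum_const,
      AddMonoidHom.card_fiber_eq_of_mem_range f (hf w) (hf w')]
  ext w
  have hmass : (Fintype.card W : ℝ) * (Q w).toReal = 1 := by
    rw [← sum_toReal_eq_one Q, Finset.sum_congr rfl fun w' _ => hconst w' w, Finset.sum_const,
      Finset.card_univ, nsmul_eq_mul]
  rw [PMF.uniformOfFintype_apply, ← ENNReal.toReal_eq_toReal_iff' (Q.apply_ne_top w) (by simp),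
    ENNReal.toReal_inv, ENNReal.toReal_natCast]
  exact eq_inv_of_mul_eq_one_right hmass

end Entropy

section LinearMap

variable {F V W U : Type*} [Field F] [AddCommGroup V] [Module F V] [AddCommGroup W] [Module F W]
  [AddCommGroup U] [Module F U]

lemma finrank_range_prod [FiniteDimensional F V] (f : V →ₗ[F] W) (h : V →ₗ[F] U) :
    Module.finrank F (f.prod h).range =
      Module.finrank F h.range + Module.finrank F (h.ker.map f) := by
  have hprod := (f.prod h).finrank_range_add_finrank_ker
  have hh := h.finrank_range_add_finrank_ker
  have hf := (f.domRestrict h.ker).finrank_range_add_finrank_ker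
  have hker : Module.finrank F (f.domRestrict h.ker).ker = Module.finrank F (f.prod h).ker := by
    rw [LinearMap.ker_domRestrict, LinearMap.ker_prod, inf_comm, ← Submodule.map_comap_subtype]
    exact (Submodule.finrank_map_subtype_eq _ _).symm
  rw [LinearMap.range_domRestrict] at hf
  omega

lemma finrank_fin_arrow [FiniteDimensional F V] (N : ℕ) :
    Module.finrank F (Fin N → V) = N * Module.finrank F V := by
  rw [Module.finrank_pi_fintype, Finset.sum_const, Finset.card_univ, Fintype.card_fin, smul_eq_mul]

lemma subtype_leftInverse_apply (D : Submodule F V) (x : D) : D.subtype.leftInverse x = x :=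
  LinearMap.leftInverse_apply_of_inj D.ker_subtype x

lemma eq_of_leftInverse_map_ker_eq (f : V →ₗ[F] W) (h : V →ₗ[F] U) {x y : V} (hh : h x = h y)
    (hf : (h.ker.map f).subtype.leftInverse (f x) = (h.ker.map f).subtype.leftInverse (f y)) :
    f x = f y := by
  have hmem : f (x - y) ∈ h.ker.map f :=
    Submodule.mem_map_of_mem (by rw [LinearMap.mem_ker, map_sub, hh, sub_self])
  have hzero : (⟨f (x - y), hmem⟩ : h.ker.map f) = 0 := by
    rw [← subtype_leftInverse_apply _ ⟨_, hmem⟩]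
    simp only [map_sub, hf, sub_self]
  rw [← sub_eq_zero, ← map_sub]
  exact congrArg Subtype.val hzero

end LinearMap

section LinearEntropy

variable {V W U : Type} [AddCommGroup V] [Module (ZMod 2) V] [AddCommGroup W] [Module (ZMod 2) W]
  [AddCommGroup U] [Module (ZMod 2) U] [Fintype W]

lemma card_eq_two_pow_finrank [Finite V] :
    Nat.card V = 2 ^ Module.finrank (ZMod 2) V := by
  rw [Module.natCard_eq_pow_finrank (K := ZMod 2), Nat.card_zmod]

lemma logb_card_eq_finrank : Real.logb 2 (Fintype.card W) = Module.finrank (ZMod 2) W := by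
  rw [← Nat.card_eq_fintype_card, card_eq_two_pow_finrank, Nat.cast_pow, Nat.cast_ofNat,
    Real.logb_pow, Real.logb_self_eq_one one_lt_two, mul_one]

lemma entropy_uniformOfFintype_linearMap [Fintype V] (f : V →ₗ[ZMod 2] W) :
    entropy (PMF.uniformOfFintype V) f = Module.finrank (ZMod 2) f.range := by
  classical
  have hrange : entropy (PMF.uniformOfFintype V) f =
      entropy (PMF.uniformOfFintype V) f.rangeRestrict :=
    le_antisymm
      (entropy_le_of_factorsThrough _ fun _ _ hxy => congrArg Subtype.val hxy)
      (entropy_le_of_factorsThrough _ fun _ _ hxy => Subtype.ext hxy)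
  rw [hrange, ← logb_card_eq_finrank]
  exact entropy_of_map_eq_uniformOfFintype <| map_uniformOfFintype_of_surjective
    (f := f.rangeRestrict.toAddMonoidHom) f.surjective_rangeRestrict

lemma entropy_prodMk_linearMap_le [Fintype U] (P : PMF V) (f : V →ₗ[ZMod 2] W)
    (h : V →ₗ[ZMod 2] U) :
    entropy P (fun x => (f x, h x)) ≤
      entropy P h + Module.finrank (ZMod 2) (h.ker.map f) := by
  classical
  have hproj : (fun x => (f x, h x)).FactorsThrough
      fun x => ((h.ker.map f).subtype.leftInverse (f x), h x) := fun x y hxy =>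
    have hh := (Prod.ext_iff.1 hxy).2
    Prod.ext (eq_of_leftInverse_map_ker_eq f h hh (Prod.ext_iff.1 hxy).1) hh
  rw [← logb_card_eq_finrank]
  exact (entropy_le_of_factorsThrough P hproj).trans (entropy_prodMk_le P _ h)

lemma entropy_uniformOfFintype_prodMk_linearMap [Fintype V] [Fintype U] (f : V →ₗ[ZMod 2] W)
    (h : V →ₗ[ZMod 2] U) :
    entropy (PMF.uniformOfFintype V) (fun x => (f x, h x)) =
      entropy (PMF.uniformOfFintype V) h + Module.finrank (ZMod 2) (h.ker.map f) := by
  rw [entropy_uniformOfFintype_linearMap h, ← Nat.cast_add, ← finrank_range_prod]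
  exact entropy_uniformOfFintype_linearMap (f.prod h)

end LinearEntropy

section Innovation

variable {K : ℕ} (n : Fin K → Fin K → ℕ)

/-- The linear map `S ^ (m - g)` that a link of gain `g` applies to its input. -/
def link (m g : ℕ) : (Fin m → ZMod 2) →ₗ[ZMod 2] (Fin m → ZMod 2) :=
  Matrix.toLin' (shift m ^ (m - g))

lemma output_eq_sum_link (l : Fin K) (x : Fin K → Sig n) :
    output n l x = ∑ i, link (levels n) (n l i) (x i) := by
  simp only [output, link, Matrix.toLin'_apply]

/-- The map `x ↦ Y_l`. -/
def outputLin (l : Fin K) : (Fin K → Sig n) →ₗ[ZMod 2] Sig n :=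
  ∑ i, link (levels n) (n l i) ∘ₗ LinearMap.proj i

@[simp]
lemma outputLin_apply (l : Fin K) (x : Fin K → Sig n) : outputLin n l x = output n l x := by
  simp only [outputLin, output_eq_sum_link, LinearMap.sum_apply, LinearMap.comp_apply,
    LinearMap.proj_apply]

/-- The map `x ↦ (X_1, …, X_{j-1}, Y_1, …, Y_{j-1})`, on which the `j`-th term of the sum-rate bound
is conditioned. -/
def past (j : Fin K) : (Fin K → Sig n) →ₗ[ZMod 2]
    ({i : Fin K // i < j} → Sig n) × ({i : Fin K // i < j} → Sig n) :=
  (LinearMap.pi fun i => LinearMap.proj i.1).prod (LinearMap.pi fun i => outputLin n i.1)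

lemma past_apply (j : Fin K) (x : Fin K → Sig n) :
    past n j x = (fun i => x i.1, fun i => output n i.1 x) := by
  ext <;> simp [past]

/-- The values of `Y_j` that are compatible with `X_1 = ⋯ = X_{j-1} = 0` and
`Y_1 = ⋯ = Y_{j-1} = 0`. By linearity, `Y_j` is known modulo this subspace once
`X_1, …, X_{j-1}, Y_1, …, Y_{j-1}` are. -/
def innovation (j : Fin K) : Submodule (ZMod 2) (Sig n) :=
  (past n j).ker.map (outputLin n j)

variable {n} in
lemma mem_innovation_iff {j : Fin K} {y : Sig n} :
    y ∈ innovation n j ↔ ∃ x : Fin K → Sig n, (∀ i < j, x i = 0) ∧ (∀ i < j, output n i x = 0) ∧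
      output n j x = y := by
  simp [innovation, past_apply, funext_iff, and_assoc]

lemma output_eq_of_leftInverse_innovation_eq {j : Fin K} {x x' : Fin K → Sig n}
    (hinput : ∀ i < j, x i = x' i) (houtput : ∀ i < j, output n i x = output n i x')
    (hproj : (innovation n j).subtype.leftInverse (output n j x) =
      (innovation n j).subtype.leftInverse (output n j x')) :
    output n j x = output n j x' := by
  have hpast : past n j x = past n j x' := by
    rw [past_apply, past_apply]
    exact Prod.ext (funext fun i => hinput i i.2) (funext fun i => houtput i i.2)
  rw [← outputLin_apply, ← outputLin_apply] at hproj ⊢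
  exact eq_of_leftInverse_map_ker_eq (outputLin n j) (past n j) hpast hproj

lemma condMutualInfo_output (P : PMF (Fin K → Sig n)) (j : Fin K) :
    condMutualInfo P (fun x => output n j x) (fun x => fun i : {i : Fin K // j ≤ i} => x i.1)
        (fun x => ((fun i : {i : Fin K // i < j} => x i.1),
          (fun i : {i : Fin K // i < j} => output n i.1 x))) =
      entropy P (fun x => (outputLin n j x, past n j x)) - entropy P (past n j) := by
  have hinput : (fun x => output n j x).FactorsThrough fun x =>
      ((fun i : {i : Fin K // j ≤ i} => x i.1), ((fun i : {i : Fin K // i < j} => x i.1),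
        (fun i : {i : Fin K // i < j} => output n i.1 x))) := by
    intro x y hxy
    simp only [Prod.mk.injEq] at hxy
    exact congrArg (output n j) <| funext fun i => (lt_or_ge i j).elim
      (fun hi => congrFun hxy.2.1 ⟨i, hi⟩) (fun hi => congrFun hxy.1 ⟨i, hi⟩)
  rw [condMutualInfo_eq_sub_of_factorsThrough P hinput]
  simp only [outputLin_apply, past_apply, funext (past_apply n j)]

theorem isSumRateOuterBound_sum_finrank_innovation :
    IsSumRateOuterBound n (∑ j, (Module.finrank (ZMod 2) (innovation n j) : ℝ)) := by
  classical
  constructor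
  · refine ⟨PMF.uniformOfFintype _, Finset.sum_congr rfl fun j _ => ?_⟩
    rw [condMutualInfo_output, entropy_uniformOfFintype_prodMk_linearMap, add_sub_cancel_left,
      innovation]
  · rintro _ ⟨P, rfl⟩
    refine Finset.sum_le_sum fun j _ => ?_
    rw [condMutualInfo_output, sub_le_iff_le_add']
    exact entropy_prodMk_linearMap_le P _ _

end Innovation

section Converse

variable {K : ℕ} {n : Fin K → Fin K → ℕ} {A : Fin K → Finset (Fin K)} {M : Fin K → Type} {N : ℕ}

namespace Code

/-- The message tuples that every receiver decodes correctly. -/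
def correct (c : Code n A M N) : Set (∀ j, M j) := {w | ∀ l, c.dec l (c.received w l) = w l}

lemma errorProb_eq_zero (c : Code n A M N) (hc : c.correct = Set.univ) : c.errorProb = 0 := by
  have herr (l : Fin K) : c.errorAt l = 0 := by
    have : IsEmpty {w : ∀ j, M j // c.dec l (c.received w l) ≠ w l} :=
      ⟨fun w => w.2 (Set.eq_univ_iff_forall.1 hc w.1 l)⟩
    rw [errorAt, Nat.card_of_isEmpty, Nat.cast_zero, zero_div]
  simp only [errorProb, herr, Real.iSup_const_zero]

lemma errorAt_le_errorProb (c : Code n A M N) (l : Fin K) : c.errorAt l ≤ c.errorProb :=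
  le_ciSup (f := fun l => c.errorAt l) (Set.finite_range _).bddAbove l

lemma card_mul_one_sub_le_ncard_correct [∀ j, Finite (M j)] (c : Code n A M N) :
    Nat.card (∀ j, M j) * (1 - K * c.errorProb) ≤ (c.correct.ncard : ℝ) := by
  have hcompl : c.correctᶜ = ⋃ l, {w | c.dec l (c.received w l) ≠ w l} := by
    ext w
    simp [correct]
  have herr (l : Fin K) : ({w | c.dec l (c.received w l) ≠ w l}.ncard : ℝ) ≤
      c.errorProb * Nat.card (∀ j, M j) :=
    calc ({w | c.dec l (c.received w l) ≠ w l}.ncard : ℝ)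
        = c.errorAt l * Nat.card (∀ j, M j) :=
          (div_mul_cancel_of_imp fun h => Nat.cast_eq_zero.2 <|
            Nat.le_zero.1 (Nat.cast_eq_zero.1 h ▸ Finite.card_subtype_le _)).symm
      _ ≤ c.errorProb * Nat.card (∀ j, M j) :=
          mul_le_mul_of_nonneg_right (c.errorAt_le_errorProb l) (Nat.cast_nonneg _)
  have hunion : (c.correctᶜ.ncard : ℝ) ≤ K * (c.errorProb * Nat.card (∀ j, M j)) :=
    calc (c.correctᶜ.ncard : ℝ)
        ≤ ∑ l, ({w | c.dec l (c.received w l) ≠ w l}.ncard : ℝ) := by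
          rw [hcompl]
          exact_mod_cast Set.ncard_iUnion_le_of_fintype _
      _ ≤ ∑ _l : Fin K, c.errorProb * Nat.card (∀ j, M j) := Finset.sum_le_sum fun l _ => herr l
      _ = K * (c.errorProb * Nat.card (∀ j, M j)) := by
          rw [Finset.sum_const, Finset.card_univ, Fintype.card_fin, nsmul_eq_mul]
  have htotal : (c.correct.ncard + c.correctᶜ.ncard : ℝ) = Nat.card (∀ j, M j) := by
    exact_mod_cast Set.ncard_add_ncard_compl c.correct
  linarith

lemma injOn_correct_leftInverse_received (c : Code n (cms K) M N) :
    Set.InjOn (fun w j t => (innovation n j).subtype.leftInverse (c.received w j t)) c.correct := by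
  intro w hw w' hw' hproj
  have hdecoded (j : Fin K) : w j = w' j ∧ c.received w j = c.received w' j := by
    induction j using WellFoundedLT.induction with
    | ind j ih =>
      have hinput (t : Fin N) (i : Fin K) (hi : i < j) :
          c.enc i (fun k => w k) t = c.enc i (fun k => w' k) t := by
        have hknown (k : {k // k ∈ cms K i}) : w k = w' k :=
          (ih k ((Finset.mem_filter.1 k.2).2.trans_lt hi)).1
        rw [funext hknown]
      have hreceived : c.received w j = c.received w' j := funext fun t =>
        output_eq_of_leftInverse_innovation_eq n (hinput t)
          (fun i hi => congrFun (ih i hi).2 t) (congrFun (congrFun hproj j) t)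
      exact ⟨by rw [← hw j, ← hw' j, hreceived], hreceived⟩
  exact funext fun j => (hdecoded j).1

lemma ncard_correct_le (c : Code n (cms K) M N) :
    c.correct.ncard ≤ 2 ^ (N * ∑ j, Module.finrank (ZMod 2) (innovation n j)) :=
  calc c.correct.ncard
      ≤ Nat.card (∀ j, Fin N → innovation n j) :=
        Nat.card_le_card_of_injective _
          (Set.injOn_iff_injective.1 c.injOn_correct_leftInverse_received)
    _ = 2 ^ (N * ∑ j, Module.finrank (ZMod 2) (innovation n j)) := by
        rw [card_eq_two_pow_finrank, Module.finrank_pi_fintype, Finset.mul_sum]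
        simp only [finrank_fin_arrow]

end Code

lemma le_of_forall_two_rpow_mul_le {u : ℕ → ℝ} {r d : ℝ}
    (hu : Filter.Tendsto u Filter.atTop (nhds 1))
    (h : ∀ N : ℕ, (2 : ℝ) ^ ((N : ℝ) * r) * u N ≤ (2 : ℝ) ^ ((N : ℝ) * d)) : r ≤ d := by
  by_contra! hlt
  have hpow (N : ℕ) : u N ≤ ((2 : ℝ) ^ (d - r)) ^ N := by
    rw [← Real.rpow_mul_natCast zero_le_two, mul_comm, mul_sub, Real.rpow_sub two_pos]
    exact (le_div_iff₀' (Real.rpow_pos_of_pos two_pos _)).2 (h N)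
  have hzero : Filter.Tendsto (fun N : ℕ => ((2 : ℝ) ^ (d - r)) ^ N) Filter.atTop (nhds 0) :=
    tendsto_pow_atTop_nhds_zero_of_lt_one (Real.rpow_nonneg zero_le_two _)
      (Real.rpow_lt_one_of_one_lt_of_neg one_lt_two (sub_neg.2 hlt))
  exact absurd (le_of_tendsto_of_tendsto' hu hzero hpow) one_pos.not_ge

lemma two_rpow_mul_sum_le_card (N : ℕ) (R : Fin K → ℝ) :
    (2 : ℝ) ^ ((N : ℝ) * ∑ i, R i) ≤ Nat.card (∀ i, Fin ⌈(2 : ℝ) ^ ((N : ℝ) * R i)⌉₊) := by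
  rw [Nat.card_pi, Finset.mul_sum, Real.rpow_sum_of_pos two_pos, Nat.cast_prod]
  refine Finset.prod_le_prod (fun i _ => (Real.rpow_pos_of_pos two_pos _).le) fun i _ => ?_
  rw [Nat.card_fin]
  exact Nat.le_ceil _

theorem sum_le_sum_finrank_innovation {R : Fin K → ℝ} (hR : R ∈ capacityRegion n (cms K)) :
    ∑ i, R i ≤ ∑ j, (Module.finrank (ZMod 2) (innovation n j) : ℝ) := by
  obtain ⟨-, c, hc⟩ := hR
  have hsuccess : Filter.Tendsto (fun N => 1 - K * (c N).errorProb) Filter.atTop (nhds 1) := by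
    simpa only [mul_zero, sub_zero] using (hc.const_mul (K : ℝ)).const_sub 1
  refine le_of_forall_two_rpow_mul_le hsuccess fun N => ?_
  rcases le_total (1 - K * (c N).errorProb) 0 with hneg | hpos
  · exact (mul_nonpos_of_nonneg_of_nonpos (by positivity) hneg).trans (by positivity)
  calc (2 : ℝ) ^ ((N : ℝ) * ∑ i, R i) * (1 - K * (c N).errorProb)
      ≤ Nat.card (∀ i, Fin ⌈(2 : ℝ) ^ ((N : ℝ) * R i)⌉₊) * (1 - K * (c N).errorProb) :=
        mul_le_mul_of_nonneg_right (two_rpow_mul_sum_le_card N R) hpos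
    _ ≤ (c N).correct.ncard := (c N).card_mul_one_sub_le_ncard_correct
    _ ≤ ((2 ^ (N * ∑ j, Module.finrank (ZMod 2) (innovation n j)) : ℕ) : ℝ) :=
        Nat.cast_le.2 (c N).ncard_correct_le
    _ = (2 : ℝ) ^ ((N : ℝ) * ∑ j, (Module.finrank (ZMod 2) (innovation n j) : ℝ)) := by
        rw [← Nat.cast_sum, ← Nat.cast_mul, Real.rpow_natCast, Nat.cast_pow, Nat.cast_ofNat]

end Converse

section LinearSchemes

variable {K : ℕ} {n : Fin K → Fin K → ℕ} {A B : Fin K → Finset (Fin K)} {M M' : Fin K → Type}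
  {N : ℕ}

lemma capacityRegion_mono : Monotone (capacityRegion n) := by
  rintro A B hAB R ⟨hR, c, hc⟩
  exact ⟨hR, fun N => ⟨fun i w => (c N).enc i fun j => w ⟨j, hAB i j.2⟩, (c N).dec⟩, hc⟩

lemma lastOnly_le_cms : lastOnly K ≤ cms K := by
  intro i j hj
  rw [cms, Finset.mem_filter, Fin.le_def]
  rw [lastOnly] at hj
  split_ifs at hj with hi
  · exact ⟨Finset.mem_univ j, by omega⟩
  · exact ⟨Finset.mem_univ j, by rw [Finset.mem_singleton.1 hj]⟩

lemma mem_lastOnly_self (i : Fin K) : i ∈ lastOnly K i := by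
  rw [lastOnly]
  split_ifs <;> simp

lemma mem_lastOnly_last {L : ℕ} (j : Fin (L + 1)) : j ∈ lastOnly (L + 1) (Fin.last L) := by
  simp [lastOnly]

namespace Code

/-- Relabel the messages of a code along bijections. -/
def reindex (c : Code n A M N) (e : ∀ j, M' j ≃ M j) : Code n A M' N where
  enc i w := c.enc i fun j => e j (w j)
  dec l y := (e l).symm (c.dec l y)

lemma correct_reindex {c : Code n A M N} (hc : c.correct = Set.univ) (e : ∀ j, M' j ≃ M j) :
    (c.reindex e).correct = Set.univ :=
  Set.eq_univ_of_forall fun w l =>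
    (e l).symm_apply_eq.2 (Set.eq_univ_iff_forall.1 hc (fun j => e j (w j)) l)

lemma IsLinear.reindex [∀ j, AddCommMonoid (M j)] [∀ j, Module (ZMod 2) (M j)]
    [∀ j, AddCommMonoid (M' j)] [∀ j, Module (ZMod 2) (M' j)] {c : Code n A M N} (hc : c.IsLinear)
    (e : ∀ j, M' j ≃ₗ[ZMod 2] M j) : (c.reindex fun j => (e j).toEquiv).IsLinear :=
  ⟨fun i => ((hc.1 i).mk' _ ∘ₗ
      LinearMap.pi fun j => (e j).toLinearMap ∘ₗ LinearMap.proj j).isLinear,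
    fun l => ((e l).symm.toLinearMap ∘ₗ (hc.2 l).mk' _).isLinear⟩

end Code

/-- A linear code without error for a single channel use, with messages in the vector spaces `V i`.
The input of transmitter `i` is a function of all messages that depends only on those in `A i`. -/
structure LinearScheme (n : Fin K → Fin K → ℕ) (A : Fin K → Finset (Fin K)) (V : Fin K → Type)
    [∀ i, AddCommGroup (V i)] [∀ i, Module (ZMod 2) (V i)] where
  input (i : Fin K) : (∀ j, V j) →ₗ[ZMod 2] Sig n
  input_congr : ∀ i w w', (∀ j ∈ A i, w j = w' j) → input i w = input i w'
  dec (l : Fin K) : Sig n →ₗ[ZMod 2] V l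
  dec_output : ∀ w l, dec l (output n l fun i => input i w) = w l

namespace LinearScheme

variable {V : Fin K → Type} [∀ i, AddCommGroup (V i)] [∀ i, Module (ZMod 2) (V i)]
  (σ : LinearScheme n A V)

/-- The encoder of transmitter `i`; the messages it does not know are replaced by zero. -/
def enc (i : Fin K) : (∀ j : {j // j ∈ A i}, V j) →ₗ[ZMod 2] Sig n :=
  σ.input i ∘ₗ LinearMap.pi fun j =>
    if h : j ∈ A i then LinearMap.proj (φ := fun k : {k // k ∈ A i} => V k) ⟨j, h⟩ else 0

lemma enc_restrict (i : Fin K) (w : ∀ j, V j) : σ.enc i (fun j => w j) = σ.input i w :=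
  σ.input_congr i _ _ fun j hj => by rw [LinearMap.pi_apply, dif_pos hj, LinearMap.proj_apply]

/-- The block code that uses a linear scheme separately in each of `N` channel uses. -/
def code (N : ℕ) : Code n A (fun i => Fin N → V i) N where
  enc i w t := σ.enc i fun j => w j t
  dec l y t := σ.dec l (y t)

lemma correct_code (N : ℕ) : (σ.code N).correct = Set.univ := by
  refine Set.eq_univ_of_forall fun w l => funext fun t => ?_
  simp only [code, Code.received, σ.enc_restrict _ fun j => w j t]
  exact σ.dec_output (fun j => w j t) l

lemma isLinear_code (N : ℕ) : (σ.code N).IsLinear :=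
  ⟨fun i => ⟨fun w w' => funext fun t => map_add (σ.enc i) (fun j => w j t) fun j => w' j t,
      fun r w => funext fun t => map_smul (σ.enc i) r fun j => w j t⟩,
    fun l => ⟨fun y y' => funext fun t => map_add (σ.dec l) (y t) (y' t),
      fun r y => funext fun t => map_smul (σ.dec l) r (y t)⟩⟩

include σ

variable [∀ i, Module.Finite (ZMod 2) (V i)]

theorem exists_isLinear_errorProb_eq_zero (N : ℕ) :
    ∃ c : Code n A (fun i => Fin (N * Module.finrank (ZMod 2) (V i)) → ZMod 2) N,
      c.IsLinear ∧ c.errorProb = 0 := by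
  let e (i : Fin K) :
      (Fin (N * Module.finrank (ZMod 2) (V i)) → ZMod 2) ≃ₗ[ZMod 2] (Fin N → V i) :=
    LinearEquiv.ofFinrankEq _ _ (by rw [Module.finrank_fin_fun, finrank_fin_arrow])
  exact ⟨(σ.code N).reindex fun i => (e i).toEquiv, (σ.isLinear_code N).reindex e,
    Code.errorProb_eq_zero _ (Code.correct_reindex (σ.correct_code N) _)⟩

theorem finrank_mem_capacityRegion :
    (fun i => (Module.finrank (ZMod 2) (V i) : ℝ)) ∈ capacityRegion n A := by
  have hfinite (i : Fin K) : Finite (V i) := Module.finite_of_finite (ZMod 2)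
  have hcard (N : ℕ) (i : Fin K) :
      Nat.card (Fin N → V i) = ⌈(2 : ℝ) ^ ((N : ℝ) * Module.finrank (ZMod 2) (V i))⌉₊ := by
    rw [card_eq_two_pow_finrank, finrank_fin_arrow, ← Nat.cast_mul, Real.rpow_natCast]
    exact_mod_cast (Nat.ceil_natCast _).symm
  refine ⟨fun i => Nat.cast_nonneg _, fun N => (σ.code N).reindex fun i =>
    (Finite.equivFinOfCardEq (hcard N i)).symm, tendsto_const_nhds.congr fun N => ?_⟩
  exact (Code.errorProb_eq_zero _ (Code.correct_reindex (σ.correct_code N) _)).symm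

theorem sum_finrank_innovation_eq (hA : A ≤ cms K)
    (hV : ∀ i, Module.finrank (ZMod 2) (innovation n i) ≤ Module.finrank (ZMod 2) (V i)) :
    ∑ i, (Module.finrank (ZMod 2) (innovation n i) : ℝ) =
      ∑ i, (Module.finrank (ZMod 2) (V i) : ℝ) :=
  le_antisymm (Finset.sum_le_sum fun i _ => Nat.cast_le.2 (hV i))
    (sum_le_sum_finrank_innovation (capacityRegion_mono hA σ.finrank_mem_capacityRegion))

theorem isSumCapacity (hAB : A ≤ B) (hB : B ≤ cms K)
    (hV : ∀ i, Module.finrank (ZMod 2) (innovation n i) ≤ Module.finrank (ZMod 2) (V i)) :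
    IsSumCapacity n B (∑ i, (Module.finrank (ZMod 2) (V i) : ℝ)) := by
  refine ⟨⟨_, capacityRegion_mono hAB σ.finrank_mem_capacityRegion, rfl⟩, ?_⟩
  rintro _ ⟨R, hR, rfl⟩
  rw [← σ.sum_finrank_innovation_eq (hAB.trans hB) hV]
  exact sum_le_sum_finrank_innovation (capacityRegion_mono hB hR)

end LinearScheme

end LinearSchemes

section Link

variable {m : ℕ}

lemma shift_pow_mulVec_apply (k : ℕ) (x : Fin m → ZMod 2) (a : Fin m) :
    (shift m ^ k).mulVec x a =
      if k ≤ (a : ℕ) then x ⟨a - k, (Nat.sub_le _ _).trans_lt a.2⟩ else 0 := by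
  induction k generalizing a with
  | zero => simp
  | succ k ih =>
    rw [pow_succ', ← Matrix.mulVec_mulVec, Matrix.mulVec, dotProduct]
    by_cases ha : 1 ≤ (a : ℕ)
    · have hne (b : Fin m) (hb : b ≠ ⟨a - 1, (Nat.sub_le _ _).trans_lt a.2⟩) :
          (a : ℕ) ≠ b + 1 := fun h => hb (Fin.ext (by simp only; omega))
      rw [Finset.sum_eq_single ⟨a - 1, (Nat.sub_le _ _).trans_lt a.2⟩
        (fun b _ hb => by simp [shift, hne b hb]) (by simp), ih]
      simp only [shift, Matrix.of_apply, Nat.sub_add_cancel ha, if_true, one_mul, Nat.sub_sub,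
        Nat.le_sub_iff_add_le ha, Nat.add_comm 1 k]
    · have hne (b : Fin m) : (a : ℕ) ≠ b + 1 := by omega
      rw [if_neg (by omega)]
      exact Finset.sum_eq_zero fun b _ => by simp [shift, hne b]

lemma link_apply (g : ℕ) (x : Fin m → ZMod 2) (a : Fin m) :
    link m g x a =
      if m - g ≤ (a : ℕ) then x ⟨a - (m - g), (Nat.sub_le _ _).trans_lt a.2⟩ else 0 := by
  rw [link, Matrix.toLin'_apply, shift_pow_mulVec_apply]

lemma link_eq_id {g : ℕ} (hg : m ≤ g) : link m g = LinearMap.id := by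
  rw [link, Nat.sub_eq_zero_of_le hg, pow_zero, Matrix.toLin'_one]

lemma ker_link {g : ℕ} (hg : g ≤ m) :
    (link m g).ker = (LinearMap.funLeft (ZMod 2) (ZMod 2) (Fin.castLE hg)).ker := by
  ext x
  simp only [LinearMap.mem_ker, funext_iff, link_apply, LinearMap.funLeft_apply, Pi.zero_apply]
  constructor
  · intro hx b
    simpa [Fin.castLE] using hx ⟨b + (m - g), by omega⟩
  · intro hx a
    split_ifs with ha
    · exact hx ⟨a - (m - g), by omega⟩
    · rfl

lemma finrank_ker_link {g : ℕ} (hg : g ≤ m) :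
    Module.finrank (ZMod 2) (link m g).ker = m - g := by
  have hrank := (LinearMap.funLeft (ZMod 2) (ZMod 2) (Fin.castLE hg)).finrank_range_add_finrank_ker
  rw [LinearMap.range_eq_top.2
    (LinearMap.funLeft_surjective_of_injective _ _ _ (Fin.castLE_injective hg)), finrank_top,
    Module.finrank_fin_fun, Module.finrank_fin_fun] at hrank
  rw [ker_link hg]
  omega

lemma isNilpotent_link {g : ℕ} (hg : g < m) : IsNilpotent (link m g) := by
  refine ⟨m, LinearMap.ext fun x => funext fun a => ?_⟩
  have hlarge : ¬(m - g) * m ≤ (a : ℕ) :=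
    not_le.2 (a.2.trans_le (Nat.le_mul_of_pos_left m (Nat.sub_pos_of_lt hg)))
  rw [link, ← Matrix.toLin'_pow, ← pow_mul, Matrix.toLin'_apply, shift_pow_mulVec_apply,
    if_neg hlarge]
  rfl

/-- The difference of the links of gains `nd` and `ni`. In the symmetric channel this is what a
receiver sees of its own user's input beyond the common signal `S ^ (m - ni) ∑ i, X_i`. -/
def linkDiff (m nd ni : ℕ) : (Fin m → ZMod 2) →ₗ[ZMod 2] (Fin m → ZMod 2) :=
  link m nd - link m ni

lemma linkDiff_self (g : ℕ) : linkDiff m g g = 0 :=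
  sub_self _

lemma bijective_linkDiff {nd ni : ℕ} (hm : m = max nd ni) (hne : nd ≠ ni) :
    Function.Bijective (linkDiff m nd ni) := by
  rw [← Module.End.isUnit_iff, linkDiff]
  rcases hne.lt_or_gt with h | h
  · obtain rfl : m = ni := hm.trans (max_eq_right h.le)
    rw [link_eq_id le_rfl]
    exact (isNilpotent_link h).isUnit_sub_one
  · obtain rfl : m = nd := hm.trans (max_eq_left h.le)
    rw [link_eq_id le_rfl]
    exact (isNilpotent_link h).isUnit_one_sub

lemma linkDiff_apply_of_mem_ker {nd ni : ℕ} (hm : m = max nd ni) {x : Fin m → ZMod 2}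
    (hx : x ∈ (link m ni).ker) : linkDiff m nd ni x = x := by
  rw [linkDiff, LinearMap.sub_apply, LinearMap.mem_ker.1 hx, sub_zero]
  rcases le_total nd ni with h | h
  · obtain rfl : m = ni := hm.trans (max_eq_right h)
    rw [link_eq_id le_rfl, LinearMap.ker_id, Submodule.mem_bot] at hx
    rw [hx, map_zero]
  · obtain rfl : m = nd := hm.trans (max_eq_left h)
    rw [link_eq_id le_rfl, LinearMap.id_apply]

end Link

section SymGain

variable {K nd ni : ℕ}

lemma le_levels (n : Fin K → Fin K → ℕ) (l i : Fin K) : n l i ≤ levels n :=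
  Finset.le_sup (f := fun p : Fin K × Fin K => n p.1 p.2) (Finset.mem_univ (l, i))

lemma levels_symGain [Nontrivial (Fin K)] : levels (symGain K nd ni) = max nd ni := by
  obtain ⟨i, j, hij⟩ := exists_pair_ne (Fin K)
  refine le_antisymm (Finset.sup_le fun p _ => ?_) (max_le ?_ ?_)
  · rw [symGain]
    split_ifs
    · exact le_max_left nd ni
    · exact le_max_right nd ni
  · simpa [symGain] using le_levels (symGain K nd ni) i i
  · simpa [symGain, hij] using le_levels (symGain K nd ni) i j

lemma output_symGain (l : Fin K) (x : Fin K → Sig (symGain K nd ni)) :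
    output (symGain K nd ni) l x = linkDiff _ nd ni (x l) + link _ ni (∑ i, x i) := by
  have hterm (i : Fin K) : link _ (symGain K nd ni l i) (x i) =
      (if l = i then linkDiff _ nd ni (x i) else 0) + link _ ni (x i) := by
    rw [symGain, linkDiff]
    split_ifs <;> simp
  rw [output_eq_sum_link, Finset.sum_congr rfl fun i _ => hterm i, Finset.sum_add_distrib,
    Finset.sum_ite_eq, if_pos (Finset.mem_univ l), map_sum]

end SymGain

section SymmetricSchemes

variable {L nd ni : ℕ}

/-- The signal spaces used when `nd ≠ ni`: everything for the first users, and the signals that do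
not interfere for the last one. -/
def privateSpace (L nd ni : ℕ) (i : Fin (L + 2)) :
    Submodule (ZMod 2) (Sig (symGain (L + 2) nd ni)) :=
  if i = Fin.last (L + 1) then (link _ ni).ker else ⊤

lemma innovation_le_privateSpace (i : Fin (L + 2)) :
    innovation (symGain (L + 2) nd ni) i ≤ privateSpace L nd ni i := by
  rw [privateSpace]
  split_ifs with hi
  · subst hi
    intro y hy
    obtain ⟨x, hx, houtput, rfl⟩ := mem_innovation_iff.1 hy
    have hsum : ∑ i, x i = x (Fin.last (L + 1)) := Finset.sum_eq_single_of_mem _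
      (Finset.mem_univ _) fun i _ hi => hx i (Fin.lt_last_iff_ne_last.2 hi)
    have hker : x (Fin.last (L + 1)) ∈ (link _ ni).ker := by
      have hfirst := houtput 0 Fin.last_pos
      rwa [output_symGain, hsum, hx 0 Fin.last_pos, map_zero, zero_add] at hfirst
    rwa [output_symGain, hsum, linkDiff_apply_of_mem_ker levels_symGain hker,
      LinearMap.mem_ker.1 hker, add_zero]
  · exact le_top

lemma privateSpace_castSucc (i : Fin (L + 1)) : privateSpace L nd ni i.castSucc = ⊤ :=
  if_neg (Fin.castSucc_ne_last i)

lemma privateSpace_last : privateSpace L nd ni (Fin.last (L + 1)) = (link _ ni).ker :=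
  if_pos rfl

lemma sum_finrank_privateSpace :
    ∑ i, (Module.finrank (ZMod 2) (privateSpace L nd ni i) : ℝ) =
      ((L + 2 : ℕ) : ℝ) * max (nd : ℝ) (ni : ℝ) - ni := by
  have hle : ni ≤ levels (symGain (L + 2) nd ni) :=
    (le_max_right nd ni).trans_eq levels_symGain.symm
  have hm : (levels (symGain (L + 2) nd ni) : ℝ) = max (nd : ℝ) (ni : ℝ) := by
    rw [levels_symGain, Nat.cast_max]
  have hinit (i : Fin (L + 1)) :
      (Module.finrank (ZMod 2) (privateSpace L nd ni i.castSucc) : ℝ) = max (nd : ℝ) (ni : ℝ) := by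
    rw [privateSpace_castSucc, finrank_top, Module.finrank_fin_fun, hm]
  rw [Fin.sum_univ_castSucc, privateSpace_last, finrank_ker_link hle, Nat.cast_sub hle, hm,
    Finset.sum_congr rfl fun i _ => hinit i, Finset.sum_const, Finset.card_univ, Fintype.card_fin,
    nsmul_eq_mul]
  push_cast
  ring

/-- The interference at the last receiver: the sum of the signals of all other users. -/
def interference (L nd ni : ℕ) :
    (∀ i, privateSpace L nd ni i) →ₗ[ZMod 2] Sig (symGain (L + 2) nd ni) :=
  ∑ i ∈ Finset.univ.erase (Fin.last (L + 1)),
    (privateSpace L nd ni i).subtype ∘ₗ LinearMap.proj i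

/-- The common signal `∑ i, X_i` of the scheme for `nd ≠ ni`. It is chosen among the signals that do
not interfere; the second summand precompensates what the last receiver sees of the interference
that the last transmitter cancels (dirty-paper coding). -/
noncomputable def commonSignal (L nd ni : ℕ) :
    (∀ i, privateSpace L nd ni i) →ₗ[ZMod 2] privateSpace L nd ni (Fin.last (L + 1)) :=
  LinearMap.proj (Fin.last (L + 1)) +
    (privateSpace L nd ni (Fin.last (L + 1))).subtype.leftInverse ∘ₗ linkDiff _ nd ni ∘ₗ
      interference L nd ni

/-- The inputs of the scheme for `nd ≠ ni`. The first users send their messages uncoded; the last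
one subtracts their sum and adds the common signal, so that no receiver sees any interference. -/
noncomputable def zeroForcingInput (L nd ni : ℕ) (i : Fin (L + 2)) :
    (∀ i, privateSpace L nd ni i) →ₗ[ZMod 2] Sig (symGain (L + 2) nd ni) :=
  if i = Fin.last (L + 1) then
    (privateSpace L nd ni (Fin.last (L + 1))).subtype ∘ₗ commonSignal L nd ni - interference L nd ni
  else (privateSpace L nd ni i).subtype ∘ₗ LinearMap.proj i

lemma sum_zeroForcingInput (w : ∀ i, privateSpace L nd ni i) :
    ∑ i, zeroForcingInput L nd ni i w = commonSignal L nd ni w := by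
  have hinit : ∑ i ∈ Finset.univ.erase (Fin.last (L + 1)), zeroForcingInput L nd ni i w =
      interference L nd ni w := by
    rw [interference, LinearMap.sum_apply]
    exact Finset.sum_congr rfl fun i hi => by
      rw [zeroForcingInput, if_neg (Finset.ne_of_mem_erase hi)]
  rw [← Finset.add_sum_erase _ _ (Finset.mem_univ (Fin.last (L + 1))), hinit, zeroForcingInput,
    if_pos rfl, LinearMap.sub_apply, sub_add_cancel, LinearMap.comp_apply, Submodule.subtype_apply]

lemma output_zeroForcingInput (w : ∀ i, privateSpace L nd ni i) (l : Fin (L + 2)) :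
    output (symGain (L + 2) nd ni) l (fun i => zeroForcingInput L nd ni i w) =
      linkDiff _ nd ni (zeroForcingInput L nd ni l w) := by
  have hker := LinearMap.mem_ker.1 (privateSpace_last.le (commonSignal L nd ni w).2)
  rw [output_symGain, sum_zeroForcingInput, hker, add_zero]

/-- The zero-forcing scheme for `nd ≠ ni`. The link difference is then invertible and fixes the
common signal, so the last receiver finds the common signal minus the link difference of the
interference, which its projection turns into its message. -/
noncomputable def zeroForcingScheme (L : ℕ) (hne : nd ≠ ni) :
    LinearScheme (symGain (L + 2) nd ni) (lastOnly (L + 2)) fun i => privateSpace L nd ni i where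
  input := zeroForcingInput L nd ni
  input_congr i w w' h := by
    by_cases hi : i = Fin.last (L + 1)
    · rw [funext fun j => h j (hi ▸ mem_lastOnly_last j)]
    · simp only [zeroForcingInput, if_neg hi, LinearMap.comp_apply, LinearMap.proj_apply,
        h i (mem_lastOnly_self i)]
  dec l := (privateSpace L nd ni l).subtype.leftInverse ∘ₗ
    if l = Fin.last (L + 1) then LinearMap.id else (linkDiff _ nd ni).leftInverse
  dec_output w l := by
    rw [output_zeroForcingInput, LinearMap.comp_apply]
    by_cases hl : l = Fin.last (L + 1)
    · subst hl
      have hcommon := (commonSignal L nd ni w).2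
      have hfix := linkDiff_apply_of_mem_ker levels_symGain (privateSpace_last.le hcommon)
      rw [if_pos rfl, LinearMap.id_apply, zeroForcingInput, if_pos rfl, LinearMap.sub_apply,
        LinearMap.comp_apply, Submodule.subtype_apply, map_sub, hfix, map_sub,
        subtype_leftInverse_apply, commonSignal, LinearMap.add_apply, LinearMap.comp_apply,
        LinearMap.comp_apply, add_sub_cancel_right, LinearMap.proj_apply]
    · rw [if_neg hl, LinearMap.leftInverse_apply_of_inj
        (LinearMap.ker_eq_bot.2 (bijective_linkDiff levels_symGain hne).1), zeroForcingInput,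
        if_neg hl, LinearMap.comp_apply, Submodule.subtype_apply, subtype_leftInverse_apply,
        LinearMap.proj_apply]

end SymmetricSchemes

section EqualGains

variable {L g : ℕ}

lemma output_symGain_self (l : Fin (L + 2)) (x : Fin (L + 2) → Sig (symGain (L + 2) g g)) :
    output (symGain (L + 2) g g) l x = ∑ i, x i := by
  rw [output_symGain, linkDiff_self, link_eq_id (levels_symGain.trans (max_self g)).le,
    LinearMap.zero_apply, zero_add, LinearMap.id_apply]

/-- The signal spaces used when `nd = ni`: every receiver sees the same sum of all inputs, so only
the first user sends anything. -/
def firstUserSpace (L g : ℕ) (i : Fin (L + 2)) :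
    Submodule (ZMod 2) (Sig (symGain (L + 2) g g)) :=
  if i = 0 then ⊤ else ⊥

lemma innovation_le_firstUserSpace (i : Fin (L + 2)) :
    innovation (symGain (L + 2) g g) i ≤ firstUserSpace L g i := by
  rw [firstUserSpace]
  split_ifs with hi
  · exact le_top
  · intro y hy
    obtain ⟨x, -, houtput, rfl⟩ := mem_innovation_iff.1 hy
    rw [Submodule.mem_bot, output_symGain_self, ← output_symGain_self 0]
    exact houtput 0 (Fin.pos_iff_ne_zero.2 hi)

lemma sum_finrank_firstUserSpace :
    ∑ i, (Module.finrank (ZMod 2) (firstUserSpace L g i) : ℝ) = g := by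
  have hm : levels (symGain (L + 2) g g) = g := levels_symGain.trans (max_self g)
  rw [Finset.sum_eq_single 0]
  · rw [firstUserSpace, if_pos rfl, finrank_top, Module.finrank_fin_fun, hm]
  · intro i _ hi
    rw [firstUserSpace, if_neg hi, finrank_bot, Nat.cast_zero]
  · simp

/-- The scheme for `nd = ni` in which the first user sends its message uncoded and all other users
are silent. -/
noncomputable def firstUserScheme (L g : ℕ) :
    LinearScheme (symGain (L + 2) g g) (lastOnly (L + 2)) fun i => firstUserSpace L g i where
  input i := (firstUserSpace L g i).subtype ∘ₗ LinearMap.proj i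
  input_congr i w w' h := by
    rw [LinearMap.comp_apply, LinearMap.comp_apply, LinearMap.proj_apply, LinearMap.proj_apply,
      h i (mem_lastOnly_self i)]
  dec l := (firstUserSpace L g l).subtype.leftInverse
  dec_output w l := by
    rw [output_symGain_self, ← subtype_leftInverse_apply _ (w l)]
    by_cases hl : l = 0
    · subst hl
      refine congrArg _ (Finset.sum_eq_single_of_mem _ (Finset.mem_univ _) fun i _ hi => ?_)
      have hbot : firstUserSpace L g i = ⊥ := if_neg hi
      exact (Submodule.mem_bot _).1 (hbot.le (w i).2)
    · have : Subsingleton (firstUserSpace L g l) := by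
        rw [firstUserSpace, if_neg hl]
        infer_instance
      exact Subsingleton.elim _ _

end EqualGains

lemma exists_linearScheme_symGain (L nd ni : ℕ) :
    ∃ D : Fin (L + 2) → Submodule (ZMod 2) (Sig (symGain (L + 2) nd ni)),
      (∀ i, innovation (symGain (L + 2) nd ni) i ≤ D i) ∧
      ∑ i, (Module.finrank (ZMod 2) (D i) : ℝ) =
        (if nd = ni then (nd : ℝ) else ((L + 2 : ℕ) : ℝ) * max (nd : ℝ) (ni : ℝ) - ni) ∧
      Nonempty (LinearScheme (symGain (L + 2) nd ni) (lastOnly (L + 2)) fun i => D i) := by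
  rcases eq_or_ne nd ni with rfl | hne
  · rw [if_pos rfl]
    exact ⟨firstUserSpace L nd, innovation_le_firstUserSpace, sum_finrank_firstUserSpace,
      ⟨firstUserScheme L nd⟩⟩
  · rw [if_neg hne]
    exact ⟨privateSpace L nd ni, innovation_le_privateSpace, sum_finrank_privateSpace,
      ⟨zeroForcingScheme L hne⟩⟩

lemma ite_mul_max_sub_div {κ d e α : ℝ} (hd : 0 < d) (he : e = α * d) :
    (if d = e then d else κ * max d e - e) / d = if α = 1 then 1 else κ * max 1 α - α := by
  subst he
  have hiff : d = α * d ↔ α = 1 := by rw [eq_comm, mul_eq_right₀ hd.ne']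
  have hmax : max d (α * d) = max 1 α * d := by rw [max_mul_of_nonneg _ _ hd.le, one_mul]
  simp only [hiff]
  split_ifs
  · exact div_self hd.ne'
  · rw [hmax, div_eq_iff hd.ne']
    ring

end CIFC

theorem mainTheorem3 (K : ℕ) (hK : 2 ≤ K) (nd ni : ℕ) :
    ∃ C : ℝ,
      -- the outer bound, maximized over the input laws, is the sum-capacity
      CIFC.IsSumRateOuterBound (CIFC.symGain K nd ni) C ∧
      CIFC.IsSumCapacity (CIFC.symGain K nd ni) (CIFC.cms K) C ∧
      -- its value, and its value normalized by the direct gain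
      C = (if nd = ni then (nd : ℝ) else (K : ℝ) * max (nd : ℝ) (ni : ℝ) - (ni : ℝ)) ∧
      (∀ α : ℝ, 0 < nd → (ni : ℝ) = α * (nd : ℝ) →
        C / (nd : ℝ) = if α = 1 then 1 else (K : ℝ) * max 1 α - α) ∧
      -- it is already the sum-capacity when only transmitter `K` is cognitive, and it is then
      -- achieved by linear codes without error
      CIFC.IsSumCapacity (CIFC.symGain K nd ni) (CIFC.lastOnly K) C ∧
      ∃ k : Fin K → ℕ, ∑ i, (k i : ℝ) = C ∧
        (fun i => (k i : ℝ)) ∈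
          CIFC.capacityRegion (CIFC.symGain K nd ni) (CIFC.lastOnly K) ∧
        ∀ N : ℕ,
          ∃ c : CIFC.Code (CIFC.symGain K nd ni) (CIFC.lastOnly K)
              (fun i => Fin (N * k i) → ZMod 2) N,
            c.IsLinear ∧ c.errorProb = 0 := by
  obtain ⟨L, rfl⟩ : ∃ L, K = L + 2 := ⟨K - 2, by omega⟩
  obtain ⟨D, hD, hsum, ⟨σ⟩⟩ := CIFC.exists_linearScheme_symGain L nd ni
  have hfinrank i := Submodule.finrank_mono (hD i)
  have hbound := CIFC.isSumRateOuterBound_sum_finrank_innovation (CIFC.symGain (L + 2) nd ni)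
  rw [σ.sum_finrank_innovation_eq CIFC.lastOnly_le_cms hfinrank] at hbound
  refine ⟨∑ i, (Module.finrank (ZMod 2) (D i) : ℝ), hbound,
    σ.isSumCapacity CIFC.lastOnly_le_cms le_rfl hfinrank, hsum, fun α hnd hα => ?_,
    σ.isSumCapacity le_rfl CIFC.lastOnly_le_cms hfinrank,
    fun i => Module.finrank (ZMod 2) (D i), rfl, σ.finrank_mem_capacityRegion,
    σ.exists_isLinear_errorProb_eq_zero⟩
  rw [hsum, ← CIFC.ite_mul_max_sub_div (Nat.cast_pos.2 hnd) hα]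
  simp only [Nat.cast_inj]
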